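/- Let $\mathbb K$ be $\mathbb R$ or $\mathbb C$. Call a finite set $A=\{n_1<\dots<n_k\}\subset\mathbb N=\{1,2,\dots\}$ admissible if $k\le n_1$, and let Schreier's space $S$ be the completion of the space $c_{00}$ of finitely supported $\mathbb K$-valued sequences $x=(x_j)_{j\ge 1}$ with respect to the norm $\|x\|_S=\sup\{\sum_{j\in A}|x_j| : A\subset\mathbb N \text{ admissible}\}$. Let $S\otimes_\pi S$ be the completed projective tensor product. For a Banach space $E$ over $\mathbb K$, a sequence $(x_n)\subset E$ is called $\mathcal P$-null if $P(x_n)\to P(0)$ for every $k$ and every continuous $k$-homogeneous polynomial $P:E\to\mathbb K$, and a set $A\subset E$ is called a Banach--Saks set if every sequence in $A$ has a subsequence whose arithmetic means converge in norm. Let $(x_n),(y_n)\subset S$ be $\mathcal P$-null sequences. Then: (a) the set $\{x_n\otimes y_n : n\in\mathbb N\}$ is a Banach--Saks set in $S\otimes_\pi S$; (b) the sequence $(x_n\otimes y_n)$ is $\mathcal P$-null in $S\otimes_\pi S$. Moreover, if $A,B\subset S$ are Banach--Saks sets, then $A\otimes B=\{a\otimes b : a\in A,\ b\in B\}$ is a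 Banach--Saks set in $S\otimes_\pi S$. -/

import Mathlib

open Filter Topology
open scoped TensorProduct

noncomputable section

/-! ### Schreier's space -/

/-- A finite set `A = {n₁ < ⋯ < n_k}` of positive integers is admissible if `k ≤ n₁`. -/
def Admissible (A : Finset ℕ+) : Prop :=
  ∀ n ∈ A, A.card ≤ (n : ℕ)

/-- The space `c₀₀` of finitely supported scalar sequences `(x₁, x₂, …)`. It is a copy of
`ℕ+ →₀ 𝕜`, made to carry the Schreier norm. -/
def SchreierC00 (𝕜 : Type*) [RCLike 𝕜] : Type _ := ℕ+ →₀ 𝕜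

namespace SchreierC00

variable {𝕜 : Type*} [RCLike 𝕜]

instance : AddCommGroup (SchreierC00 𝕜) := inferInstanceAs (AddCommGroup (ℕ+ →₀ 𝕜))

instance : Module 𝕜 (SchreierC00 𝕜) := inferInstanceAs (Module 𝕜 (ℕ+ →₀ 𝕜))

/-- The `j`-th coordinate of a finitely supported sequence. -/
def coord (x : SchreierC00 𝕜) (j : ℕ+) : 𝕜 := (show ℕ+ →₀ 𝕜 from x) j

/-- The Schreier norm: the supremum of `∑ j ∈ A, |x j|` over the admissible sets `A`. -/
instance : Norm (SchreierC00 𝕜) :=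
  ⟨fun x => ⨆ A : {A : Finset ℕ+ // Admissible A}, ∑ j ∈ A.1, ‖x.coord j‖⟩

theorem norm_def (x : SchreierC00 𝕜) :
    ‖x‖ = ⨆ A : {A : Finset ℕ+ // Admissible A}, ∑ j ∈ A.1, ‖x.coord j‖ := rfl

@[simp] theorem coord_add (x y : SchreierC00 𝕜) (j : ℕ+) :
    (x + y).coord j = x.coord j + y.coord j := rfl

@[simp] theorem coord_smul (c : 𝕜) (x : SchreierC00 𝕜) (j : ℕ+) :
    (c • x).coord j = c * x.coord j := rfl

@[simp] theorem coord_zero (j : ℕ+) : (0 : SchreierC00 𝕜).coord j = 0 := rfl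

theorem ext_coord {x y : SchreierC00 𝕜} (h : ∀ j, x.coord j = y.coord j) : x = y :=
  Finsupp.ext h

theorem bddAbove_sums (x : SchreierC00 𝕜) :
    BddAbove (Set.range fun A : {A : Finset ℕ+ // Admissible A} => ∑ j ∈ A.1, ‖x.coord j‖) := by
  classical
  refine ⟨∑ j ∈ (show ℕ+ →₀ 𝕜 from x).support, ‖x.coord j‖, ?_⟩
  rintro _ ⟨A, rfl⟩
  have hsub : A.1 ⊆ A.1 ∪ (show ℕ+ →₀ 𝕜 from x).support := Finset.subset_union_left
  refine (Finset.sum_le_sum_of_subset_of_nonneg hsub fun _ _ _ => norm_nonneg _).trans ?_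
  refine (Finset.sum_subset Finset.subset_union_right fun j _ hj => ?_).ge
  rw [Finsupp.notMem_support_iff] at hj
  exact norm_eq_zero.2 hj

theorem sum_le_norm (x : SchreierC00 𝕜) {A : Finset ℕ+} (hA : Admissible A) :
    ∑ j ∈ A, ‖x.coord j‖ ≤ ‖x‖ :=
  le_ciSup x.bddAbove_sums ⟨A, hA⟩

theorem admissible_empty : Admissible ∅ := by simp [Admissible]

theorem admissible_singleton (j : ℕ+) : Admissible {j} := by
  intro n _
  rw [Finset.card_singleton]
  exact n.pos

instance : Nonempty {A : Finset ℕ+ // Admissible A} := ⟨⟨∅, admissible_empty⟩⟩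

theorem norm_core : NormedSpace.Core 𝕜 (SchreierC00 𝕜) where
  norm_nonneg x := by simpa using x.sum_le_norm admissible_empty
  norm_smul c x := by
    simp only [norm_def, coord_smul, norm_mul, ← Finset.mul_sum]
    rw [Real.mul_iSup_of_nonneg (norm_nonneg c)]
  norm_triangle x y := by
    refine ciSup_le fun A => ?_
    calc ∑ j ∈ A.1, ‖(x + y).coord j‖
        ≤ ∑ j ∈ A.1, (‖x.coord j‖ + ‖y.coord j‖) :=
          Finset.sum_le_sum fun j _ => norm_add_le _ _
      _ = ∑ j ∈ A.1, ‖x.coord j‖ + ∑ j ∈ A.1, ‖y.coord j‖ := Finset.sum_add_distrib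
      _ ≤ ‖x‖ + ‖y‖ := add_le_add (x.sum_le_norm A.2) (y.sum_le_norm A.2)
  norm_eq_zero_iff x := by
    constructor
    · intro h
      refine ext_coord fun j => ?_
      have hj := x.sum_le_norm (admissible_singleton j)
      rw [h, Finset.sum_singleton] at hj
      simpa using hj
    · rintro rfl
      simp [norm_def]

instance : NormedAddCommGroup (SchreierC00 𝕜) := NormedAddCommGroup.ofCore norm_core

instance : NormedSpace 𝕜 (SchreierC00 𝕜) := NormedSpace.ofCore norm_core

end SchreierC00

/-- Schreier's space `S`: the completion of `c₀₀` for the Schreier norm. -/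
abbrev Schreier (𝕜 : Type*) [RCLike 𝕜] : Type _ :=
  UniformSpace.Completion (SchreierC00 𝕜)

/-! ### Polynomials, `𝒫`-convergence, Banach–Saks sets -/

/-- `P` is a continuous `k`-homogeneous scalar-valued polynomial on `E`: the restriction to the
diagonal of a continuous `k`-linear form. -/
def IsHomogeneousPolynomial (𝕜 : Type*) {E : Type*} [RCLike 𝕜] [NormedAddCommGroup E]
    [NormedSpace 𝕜 E] (k : ℕ) (P : E → 𝕜) : Prop :=
  ∃ L : ContinuousMultilinearMap 𝕜 (fun _ : Fin k => E) 𝕜, ∀ x, P x = L fun _ => x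

/-- `(x n)` is `𝒫`-convergent to `a`: `P (x n) → P a` for all continuous homogeneous
polynomials `P` of any degree. -/
def PConvergesTo (𝕜 : Type*) {E : Type*} [RCLike 𝕜] [NormedAddCommGroup E]
    [NormedSpace 𝕜 E] (x : ℕ → E) (a : E) : Prop :=
  ∀ (k : ℕ) (P : E → 𝕜), IsHomogeneousPolynomial 𝕜 k P →
    Tendsto (fun n => P (x n)) atTop (𝓝 (P a))

/-- `(x n)` is `𝒫`-null: it is `𝒫`-convergent to zero. -/
def IsPNull (𝕜 : Type*) {E : Type*} [RCLike 𝕜] [NormedAddCommGroup E]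
    [NormedSpace 𝕜 E] (x : ℕ → E) : Prop :=
  PConvergesTo 𝕜 x 0

/-- `A` is a Banach–Saks set: every sequence in `A` has a subsequence whose arithmetic means
converge in norm. -/
def IsBanachSaksSet (𝕜 : Type*) {E : Type*} [RCLike 𝕜] [NormedAddCommGroup E]
    [NormedSpace 𝕜 E] (A : Set E) : Prop :=
  ∀ x : ℕ → E, (∀ n, x n ∈ A) → ∃ φ : ℕ → ℕ, StrictMono φ ∧ ∃ a : E,
    Tendsto (fun N : ℕ => (N : 𝕜)⁻¹ • ∑ i ∈ Finset.range N, x (φ i)) atTop (𝓝 a)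

/-! ### The projective tensor product -/

/-- The projective tensor product `E ⊗_π E`: the completion of the algebraic tensor product
`E ⊗ E` for the projective norm `u ↦ inf ∑ |c j| ‖a j‖ ‖b j‖`, the infimum being over all
representations `u = ∑ c j • (a j ⊗ b j)`. This is the norm that `PiTensorProduct` carries
in Mathlib. -/
abbrev ProjectiveTensorSquare (𝕜 E : Type*) [RCLike 𝕜] [NormedAddCommGroup E]
    [NormedSpace 𝕜 E] : Type _ :=
  UniformSpace.Completion (⨂[𝕜] _ : Fin 2, E)

/-- The elementary tensor `a ⊗ b` in `E ⊗_π E`. -/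
def elemTensor (𝕜 : Type*) {E : Type*} [RCLike 𝕜] [NormedAddCommGroup E]
    [NormedSpace 𝕜 E] (a b : E) : ProjectiveTensorSquare 𝕜 E :=
  ((PiTensorProduct.tprod 𝕜 ![a, b] : ⨂[𝕜] _ : Fin 2, E) : ProjectiveTensorSquare 𝕜 E)

end

/-! ### Extraction of subsequences -/

/-! Everything passes through one intermediate notion: a bounded sequence in $S$ whose coordinates
tend to zero uniformly (`SupNull`). By a gliding hump argument such a sequence has a weakly
unconditionally Cauchy (wuc) subsequence, since an admissible set sees at most one of the sparse
terms substantially (`SupNull.exists_isWUCWith`).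

Both hypotheses lead to this notion. If $(x_n)$ is $\mathcal P$-null but not `SupNull`, a gliding
hump produces separated large coordinates $j_k$, and the quadratic form $\sum_k x(j_k)^2$ does not
tend to zero along the sequence. This form is continuous because the $k$-th largest coordinate of
$x$ is at most $2\|x\|/k$ (`sum_sq_le`). If $(x_n)$ lies in a Banach–Saks set, a subsequence differs
from a fixed vector by a `SupNull` sequence; otherwise humps on an admissible set keep the means
away from their limit.

The wuc property survives bilinear maps on the diagonal, by averaging over signs
(`IsWUCWith.bilinear`). Hence tensors of wuc sequences are wuc, so their partial sums are bounded
and their means are $O(1/N)$. Iterating over the degree, a homogeneous polynomial of positive degree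
sends a wuc sequence to an absolutely summable scalar sequence, which is null. -/

theorem exists_strictMono_forall_lt {R : ℕ → ℕ → ℕ → Prop}
    (hR : ∀ m l, ∀ᶠ n in atTop, R m l n)
    (hmono : ∀ m l l' n, l' ≤ l → R m l n → R m l' n) :
    ∃ φ : ℕ → ℕ, StrictMono φ ∧ ∀ k l, k < l → R (φ k) l (φ l) := by
  -- Each chosen index carries a level. Levels increase strictly, so the $l$-th one is at least $l$,
  -- and `hmono` then lowers it to $l$. Tolerances may thus depend on the position in the
  -- subsequence.
  obtain ⟨f, -, hf⟩ := exists_seq_of_forall_finset_exists (fun _ : ℕ × ℕ => True)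
    (fun p q => p.1 < q.1 ∧ p.2 < q.2 ∧ R p.2 q.1 q.2) (by
      intro s _
      set l := s.sup Prod.fst + 1 with hl
      have h1 : ∀ᶠ n in atTop, ∀ p ∈ s, p.2 < n ∧ R p.2 l n :=
        (Filter.eventually_all_finset s).2 fun p _ => (eventually_gt_atTop p.2).and (hR p.2 l)
      obtain ⟨n, hn⟩ := h1.exists
      exact ⟨(l, n), trivial, fun p hp =>
        ⟨Nat.lt_succ_of_le (Finset.le_sup (f := Prod.fst) hp), (hn p hp).1, (hn p hp).2⟩⟩)
  have h1 : StrictMono fun n => (f n).1 := fun m n h => (hf m n h).1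
  exact ⟨fun n => (f n).2, fun m n h => (hf m n h).2.1,
    fun k l h => hmono _ _ _ _ h1.le_apply (hf k l h).2.2⟩

theorem exists_strictMono_eq_or_tendsto (f : ℕ → ℕ) :
    (∃ φ : ℕ → ℕ, StrictMono φ ∧ ∃ c, ∀ n, f (φ n) = c) ∨ Tendsto f atTop atTop := by
  by_cases h : ∃ c, ∃ᶠ n in atTop, f n = c
  · obtain ⟨c, hc⟩ := h
    obtain ⟨φ, h1, h2⟩ := extraction_of_frequently_atTop hc
    exact Or.inl ⟨φ, h1, c, h2⟩
  · right
    rw [← Nat.cofinite_eq_atTop, Tendsto, le_cofinite_iff_eventually_ne]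
    intro c
    rw [Nat.cofinite_eq_atTop]
    have := not_frequently.1 (not_exists.1 h c)
    exact this

/-! ### Weakly unconditionally Cauchy sequences -/

section WUC

universe u

variable {𝕜 E F G : Type*} [RCLike 𝕜] [NormedAddCommGroup E] [NormedSpace 𝕜 E]
  [NormedAddCommGroup F] [NormedSpace 𝕜 F] [NormedAddCommGroup G] [NormedSpace 𝕜 G]

/-- The series `∑ x n` is weakly unconditionally Cauchy, with constant `C`. -/
def IsWUCWith (𝕜 : Type*) {E : Type*} [RCLike 𝕜] [NormedAddCommGroup E] [NormedSpace 𝕜 E]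
    (C : ℝ) (x : ℕ → E) : Prop :=
  ∀ (s : Finset ℕ) (a : ℕ → 𝕜), (∀ i, ‖a i‖ ≤ 1) → ‖∑ i ∈ s, a i • x i‖ ≤ C

namespace IsWUCWith

variable {C D : ℝ} {x : ℕ → E} {y : ℕ → F}

theorem nonneg (hx : IsWUCWith 𝕜 C x) : 0 ≤ C := by
  simpa using hx ∅ 0 (by simp)

theorem comp (hx : IsWUCWith 𝕜 C x) {φ : ℕ → ℕ} (hφ : Function.Injective φ) :
    IsWUCWith 𝕜 C (x ∘ φ) := by
  intro s a ha
  have := hx (s.map ⟨φ, hφ⟩) (a ∘ Function.invFun φ) fun i => ha _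
  simpa [Function.leftInverse_invFun hφ _] using this

theorem add {x y : ℕ → E} (hx : IsWUCWith 𝕜 C x) (hy : IsWUCWith 𝕜 D y) :
    IsWUCWith 𝕜 (C + D) (fun n => x n + y n) := by
  intro s a ha
  simp only [smul_add, Finset.sum_add_distrib]
  exact (norm_add_le _ _).trans (add_le_add (hx s a ha) (hy s a ha))

theorem map (hx : IsWUCWith 𝕜 C x) (T : E →L[𝕜] F) :
    IsWUCWith 𝕜 (‖T‖ * C) (fun n => T (x n)) := by
  intro s a ha
  have : ∑ i ∈ s, a i • T (x i) = T (∑ i ∈ s, a i • x i) := by simp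
  rw [this]
  exact T.le_opNorm_of_le (hx s a ha)

theorem sum_update_smul_of_notMem {s : Finset ℕ} {j : ℕ} (hj : j ∉ s) (a : ℕ → 𝕜) (e : 𝕜)
    (z : ℕ → E) : ∑ i ∈ s, Function.update a j e i • z i = ∑ i ∈ s, a i • z i :=
  Finset.sum_congr rfl fun i hi => by rw [Function.update_of_ne (ne_of_mem_of_not_mem hi hj)]

/-- Averaging $B(u+ex, v+ey)$ over $e=\pm1$ cancels the cross terms and leaves $B(u,v)+B(x,y)$. The
vectors $u,v$ are general so that the induction can absorb one signed term at a time. -/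
theorem norm_add_sum_apply_le (B : E →L[𝕜] F →L[𝕜] G) (x : ℕ → E) (y : ℕ → F) (K : ℝ)
    (s : Finset ℕ) : ∀ (u : E) (v : F), (∀ a : ℕ → 𝕜, (∀ i, ‖a i‖ ≤ 1) →
      ‖B (u + ∑ i ∈ s, a i • x i) (v + ∑ i ∈ s, a i • y i)‖ ≤ K) →
      ‖B u v + ∑ i ∈ s, B (x i) (y i)‖ ≤ K := by
  classical
  induction s using Finset.induction_on with
  | empty => intro u v h; simpa using h 0 (by simp)
  | insert j s hj ih =>
    intro u v h
    have key : ∀ e : 𝕜, ‖e‖ = 1 →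
        ‖B (u + e • x j) (v + e • y j) + ∑ i ∈ s, B (x i) (y i)‖ ≤ K := by
      intro e he
      refine ih _ _ fun a ha => ?_
      have h1 := h (Function.update a j e) (by
        intro i
        rcases eq_or_ne i j with rfl | hi
        · simp [he]
        · simpa [hi] using ha i)
      rw [Finset.sum_insert hj, Finset.sum_insert hj, Function.update_self, sum_update_smul_of_notMem hj,
        sum_update_smul_of_notMem hj, ← add_assoc, ← add_assoc] at h1
      exact h1
    have h1 := key 1 (by simp)
    have h2 := key (-1) (by simp)
    have h3 : (2 : 𝕜) • (B u v + ∑ i ∈ insert j s, B (x i) (y i)) =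
        (B (u + (1 : 𝕜) • x j) (v + (1 : 𝕜) • y j) + ∑ i ∈ s, B (x i) (y i)) +
        (B (u + (-1 : 𝕜) • x j) (v + (-1 : 𝕜) • y j) + ∑ i ∈ s, B (x i) (y i)) := by
      rw [Finset.sum_insert hj]
      simp only [one_smul, neg_smul, map_add, map_neg, add_apply,
        neg_apply, two_smul]
      abel
    have h4 := norm_add_le_of_le h1 h2
    rw [← h3, norm_smul, RCLike.norm_two] at h4
    linarith

theorem bilinear (hx : IsWUCWith 𝕜 C x) (hy : IsWUCWith 𝕜 D y) (B : E →L[𝕜] F →L[𝕜] G) :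
    IsWUCWith 𝕜 (‖B‖ * C * D) (fun n => B (x n) (y n)) := by
  intro s a ha
  -- The coefficients $a_i$ are absorbed into the first sequence, leaving a pure diagonal sum.
  have := norm_add_sum_apply_le B (fun i => a i • x i) y (‖B‖ * C * D) s 0 0 (by
    intro b hb
    rw [zero_add, zero_add]
    refine (B.le_opNorm₂ _ _).trans ?_
    have h1 : ‖∑ i ∈ s, b i • a i • x i‖ ≤ C := by
      simp only [smul_smul]
      refine hx s (fun i => b i * a i) fun i => ?_
      rw [norm_mul]
      exact mul_le_one₀ (hb i) (norm_nonneg _) (ha i)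
    have h2 := hy s b hb
    have := hx.nonneg
    gcongr)
  simpa using this

/-- Currying the last variable writes $L(x,\dots,x)$ as the evaluation pairing applied to two wuc
sequences. The target changes from `G` to `E →L[𝕜] G` in the induction, so both spaces share a
universe. -/
theorem multilinear {E : Type u} [NormedAddCommGroup E] [NormedSpace 𝕜 E] {x : ℕ → E}
    (hx : IsWUCWith 𝕜 C x) (k : ℕ) :
    ∀ (G : Type u) [NormedAddCommGroup G] [NormedSpace 𝕜 G]
      (L : ContinuousMultilinearMap 𝕜 (fun _ : Fin (k + 1) => E) G),
      ∃ D, IsWUCWith 𝕜 D (fun n => L fun _ => x n) := by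
  induction k with
  | zero =>
    intro G _ _ L
    refine ⟨‖L.toContinuousLinearMap 0 0‖ * C, ?_⟩
    · convert hx.map (L.toContinuousLinearMap 0 0) using 2 with n
      exact congrArg L (funext fun i => by
        have hi : i = 0 := Fin.fin_one_eq_zero i
        simp [hi])
  | succ k ih =>
    intro G _ _ L
    obtain ⟨D, hD⟩ := ih (E →L[𝕜] G) L.curryRight
    refine ⟨‖ContinuousLinearMap.id 𝕜 (E →L[𝕜] G)‖ * D * C, ?_⟩
    · convert hD.bilinear hx (ContinuousLinearMap.id 𝕜 (E →L[𝕜] G)) using 2 with n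
      simp only [ContinuousLinearMap.id_apply, ContinuousMultilinearMap.curryRight_apply]
      refine congrArg L (funext fun i => ?_)
      refine Fin.lastCases ?_ (fun i => ?_) i <;> simp

/-- Unimodular coefficients turn the sums into $\sum|z_i|$, so a scalar wuc series converges
absolutely. -/
theorem tendsto_zero_of_scalar {z : ℕ → 𝕜} (hz : IsWUCWith 𝕜 C z) :
    Tendsto z atTop (𝓝 0) := by
  have hs : Summable fun n => ‖z n‖ := by
    refine summable_of_sum_le (c := C) (fun _ => norm_nonneg _) fun s => ?_
    have hc : ∀ i, ∃ c : 𝕜, ‖c‖ ≤ 1 ∧ c * z i = (‖z i‖ : 𝕜) := by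
      intro i
      obtain ⟨c, h1, h2⟩ := RCLike.exists_norm_eq_mul_self (z i)
      exact ⟨c, h1.le, h2.symm⟩
    choose c h1 h2 using hc
    have := hz s c h1
    simp only [smul_eq_mul, h2] at this
    rw [← RCLike.ofReal_sum, RCLike.norm_ofReal] at this
    exact (le_abs_self _).trans this
  exact tendsto_zero_iff_norm_tendsto_zero.2 hs.tendsto_atTop_zero

theorem tendsto_polynomial {𝕜 E : Type u} [RCLike 𝕜] [NormedAddCommGroup E] [NormedSpace 𝕜 E]
    {x : ℕ → E} (hx : IsWUCWith 𝕜 C x) {k : ℕ} {P : E → 𝕜}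
    (hP : IsHomogeneousPolynomial 𝕜 k P) : Tendsto (fun n => P (x n)) atTop (𝓝 (P 0)) := by
  obtain ⟨L, hL⟩ := hP
  simp only [hL]
  cases k with
  | zero =>
    have : ∀ n, (L fun _ => x n) = L fun _ => 0 := fun n => congrArg L (Subsingleton.elim _ _)
    simp only [this]
    exact tendsto_const_nhds
  | succ k =>
    obtain ⟨D, hD⟩ := hx.multilinear k 𝕜 L
    have : (L fun _ => (0 : E)) = 0 := L.map_zero
    rw [this]
    exact hD.tendsto_zero_of_scalar

theorem tendsto_mean {z : ℕ → E} {c : E} (hz : IsWUCWith 𝕜 C (fun n => z n - c)) :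
    Tendsto (fun N : ℕ => (N : 𝕜)⁻¹ • ∑ i ∈ Finset.range N, z i) atTop (𝓝 c) := by
  rw [tendsto_iff_norm_sub_tendsto_zero]
  refine squeeze_zero' (Eventually.of_forall fun _ => norm_nonneg _) ?_
    (tendsto_const_div_atTop_nhds_zero_nat C)
  filter_upwards [eventually_gt_atTop 0] with N hN
  have hN' : (N : 𝕜) ≠ 0 := by exact_mod_cast hN.ne'
  have h1 : (N : 𝕜)⁻¹ • ∑ i ∈ Finset.range N, z i - c =
      (N : 𝕜)⁻¹ • ∑ i ∈ Finset.range N, (1 : 𝕜) • (z i - c) := by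
    simp only [one_smul, Finset.sum_sub_distrib, Finset.sum_const, Finset.card_range, smul_sub]
    rw [← Nat.cast_smul_eq_nsmul 𝕜, smul_smul, inv_mul_cancel₀ hN', one_smul]
  rw [h1, norm_smul, norm_inv, RCLike.norm_natCast, div_eq_inv_mul]
  have := hz (Finset.range N) (fun _ => 1) (by simp)
  gcongr

end IsWUCWith

end WUC

/-! ### Coordinates on Schreier's space -/

namespace SchreierC00

variable {𝕜 : Type*} [RCLike 𝕜]

/-- The `j`-th coordinate functional on `c₀₀`. -/
noncomputable def coordL (𝕜 : Type*) [RCLike 𝕜] (j : ℕ+) : SchreierC00 𝕜 →L[𝕜] 𝕜 :=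
  LinearMap.mkContinuous
    { toFun := fun x => x.coord j
      map_add' := fun _ _ => rfl
      map_smul' := fun _ _ => rfl } 1 fun x => by
    have := x.sum_le_norm (admissible_singleton j)
    rw [Finset.sum_singleton] at this
    rw [one_mul]
    exact this

theorem exists_forall_coord_eq_zero (x : SchreierC00 𝕜) :
    ∃ N : ℕ, ∀ j : ℕ+, N < j → x.coord j = 0 := by
  refine ⟨(show ℕ+ →₀ 𝕜 from x).support.sup (fun j => (j : ℕ)), fun j hj => ?_⟩
  by_contra h
  have hj' : j ∈ (show ℕ+ →₀ 𝕜 from x).support := Finsupp.mem_support_iff.2 h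
  exact absurd (Finset.le_sup (f := fun j : ℕ+ => (j : ℕ)) hj') (not_le.2 hj)

end SchreierC00

namespace Schreier

variable {𝕜 : Type*} [RCLike 𝕜]

/-- The `j`-th coordinate functional on Schreier's space. -/
noncomputable def coord (𝕜 : Type*) [RCLike 𝕜] (j : ℕ+) : Schreier 𝕜 →L[𝕜] 𝕜 :=
  (SchreierC00.coordL 𝕜 j).extend UniformSpace.Completion.toComplL

@[simp] theorem coord_coe (j : ℕ+) (x : SchreierC00 𝕜) :
    coord 𝕜 j (x : Schreier 𝕜) = x.coord j :=
  ContinuousLinearMap.extend_eq (SchreierC00.coordL 𝕜 j)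
    (e := UniformSpace.Completion.toComplL) UniformSpace.Completion.denseRange_coe
    (UniformSpace.Completion.isUniformInducing_coe _) x

theorem sum_le_norm (x : Schreier 𝕜) {A : Finset ℕ+} (hA : Admissible A) :
    ∑ j ∈ A, ‖coord 𝕜 j x‖ ≤ ‖x‖ := by
  induction x using UniformSpace.Completion.induction_on with
  | hp => exact isClosed_le (by fun_prop) continuous_norm
  | ih x => simpa using x.sum_le_norm hA

theorem norm_coord_le (x : Schreier 𝕜) (j : ℕ+) : ‖coord 𝕜 j x‖ ≤ ‖x‖ := by
  simpa using sum_le_norm x (SchreierC00.admissible_singleton j)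

theorem exists_coe_norm_sub_lt (x : Schreier 𝕜) {δ : ℝ} (hδ : 0 < δ) :
    ∃ y : SchreierC00 𝕜, ‖x - y‖ < δ := by
  obtain ⟨y, hy⟩ := UniformSpace.Completion.denseRange_coe.exists_dist_lt x hδ
  exact ⟨y, by rwa [← dist_eq_norm]⟩

/-- By density of $c_{00}$, the norm of the completion is still computed by admissible coordinate
sums. -/
theorem norm_le_of_forall_sum_le {x : Schreier 𝕜} {C : ℝ}
    (h : ∀ A, Admissible A → ∑ j ∈ A, ‖coord 𝕜 j x‖ ≤ C) : ‖x‖ ≤ C := by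
  refine le_of_forall_pos_le_add fun δ hδ => ?_
  obtain ⟨y, hy⟩ := exists_coe_norm_sub_lt x (half_pos hδ)
  have h1 : ‖(y : Schreier 𝕜)‖ ≤ C + δ / 2 := by
    rw [UniformSpace.Completion.norm_coe, SchreierC00.norm_def]
    refine ciSup_le fun A => ?_
    calc ∑ j ∈ A.1, ‖y.coord j‖
        ≤ ∑ j ∈ A.1, (‖coord 𝕜 j x‖ + ‖coord 𝕜 j (x - y)‖) := by
          refine Finset.sum_le_sum fun j _ => ?_
          have : y.coord j = coord 𝕜 j x - coord 𝕜 j (x - y) := by simp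
          rw [this]
          exact norm_sub_le _ _
      _ ≤ C + δ / 2 := by
          rw [Finset.sum_add_distrib]
          exact add_le_add (h _ A.2) ((sum_le_norm _ A.2).trans hy.le)
  have h2 : ‖x‖ ≤ ‖x - y‖ + ‖(y : Schreier 𝕜)‖ := by
    simpa using norm_add_le (x - y) (y : Schreier 𝕜)
  linarith

theorem ext_coord {x y : Schreier 𝕜} (h : ∀ j, coord 𝕜 j x = coord 𝕜 j y) : x = y := by
  rw [← sub_eq_zero, ← norm_le_zero_iff]
  exact norm_le_of_forall_sum_le fun A _ => by simp [h]

theorem exists_tail_sum_le (x : Schreier 𝕜) {δ : ℝ} (hδ : 0 < δ) :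
    ∃ N : ℕ, ∀ A, Admissible A → (∀ j ∈ A, N < (j : ℕ)) → ∑ j ∈ A, ‖coord 𝕜 j x‖ ≤ δ := by
  obtain ⟨y, hy⟩ := exists_coe_norm_sub_lt x hδ
  obtain ⟨N, hN⟩ := y.exists_forall_coord_eq_zero
  refine ⟨N, fun A hA h => le_trans (le_of_eq ?_) ((sum_le_norm (x - (y : Schreier 𝕜)) hA).trans hy.le)⟩
  refine Finset.sum_congr rfl fun j hj => ?_
  simp [hN j (h j hj)]

/-! ### Decay and square-summability of coordinates -/

/-- With $h=\lceil |s|/2\rceil$, at most $h-1$ positive integers lie below $h$, so $s$ has $h$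
elements that are at least $h$. These form an admissible set, on which the smallest coordinate
counts $h$ times. -/
theorem exists_card_mul_norm_coord_le (x : Schreier 𝕜) {s : Finset ℕ+} (hs : s.Nonempty) :
    ∃ j ∈ s, (s.card : ℝ) * ‖coord 𝕜 j x‖ ≤ 2 * ‖x‖ := by
  obtain ⟨j, hj, hmin⟩ := s.exists_min_image (fun j => ‖coord 𝕜 j x‖) hs
  refine ⟨j, hj, ?_⟩
  set h := (s.card + 1) / 2 with hh
  have h1 : (s.filter fun i : ℕ+ => (i : ℕ) < h).card ≤ h - 1 := by
    have : (s.filter fun i : ℕ+ => (i : ℕ) < h).card ≤ (Finset.Ico 1 h).card :=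
      Finset.card_le_card_of_injOn (fun i : ℕ+ => (i : ℕ))
        (fun i hi => by
          have := (Finset.mem_filter.1 hi).2
          exact Finset.mem_coe.2 (Finset.mem_Ico.2 ⟨i.pos, this⟩))
        (fun i _ k _ hik => PNat.coe_injective hik)
    simpa using this
  have h2 := Finset.card_filter_add_card_filter_not (s := s) (fun i : ℕ+ => (i : ℕ) < h)
  have h0 : 0 < s.card := hs.card_pos
  have h3 : h ≤ (s.filter fun i : ℕ+ => ¬ (i : ℕ) < h).card := by omega
  obtain ⟨A, hA, hcard⟩ := Finset.exists_subset_card_eq h3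
  have hadm : Admissible A := by
    intro n hn
    have := (Finset.mem_filter.1 (hA hn)).2
    omega
  have h4 : (h : ℝ) * ‖coord 𝕜 j x‖ ≤ ‖x‖ := by
    refine le_trans ?_ (sum_le_norm x hadm)
    rw [← hcard, ← nsmul_eq_mul]
    exact Finset.card_nsmul_le_sum _ _ _ fun i hi => hmin i (Finset.mem_filter.1 (hA hi)).1
  have h5 : (s.card : ℝ) ≤ 2 * h := by
    have : s.card ≤ 2 * h := by omega
    exact_mod_cast this
  nlinarith [norm_nonneg (coord 𝕜 j x)]

theorem sum_sq_le (x : Schreier 𝕜) (s : Finset ℕ+) :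
    ∑ j ∈ s, ‖coord 𝕜 j x‖ ^ 2 ≤ 8 * ‖x‖ ^ 2 := by
  -- Removing the smallest coordinate repeatedly gives $4\|x\|^2\sum_{k\le n+1}1/k^2$, and
  -- $2-1/(n+1)$ is the telescoping bound for this sum.
  have key : ∀ n : ℕ, ∀ s : Finset ℕ+, s.card = n + 1 →
      ∑ j ∈ s, ‖coord 𝕜 j x‖ ^ 2 ≤ 4 * ‖x‖ ^ 2 * (2 - 1 / (n + 1)) := by
    intro n
    induction n with
    | zero =>
      intro s hs
      obtain ⟨j, rfl⟩ := Finset.card_eq_one.1 hs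
      have := norm_coord_le x j
      have : ‖coord 𝕜 j x‖ ^ 2 ≤ ‖x‖ ^ 2 := by gcongr
      simp
      nlinarith [sq_nonneg ‖x‖]
    | succ n ih =>
      intro s hs
      obtain ⟨j, hj, hle⟩ := exists_card_mul_norm_coord_le x (s := s)
        (Finset.card_pos.1 (by omega))
      rw [← Finset.add_sum_erase s _ hj]
      have h1 := ih (s.erase j) (by rw [Finset.card_erase_of_mem hj]; omega)
      rw [hs] at hle
      push_cast at hle ⊢
      set t := ‖coord 𝕜 j x‖
      have hn : (0 : ℝ) ≤ n := n.cast_nonneg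
      have h2 : t ≤ 2 * ‖x‖ / (n + 1 + 1) := by
        rw [le_div_iff₀ (by positivity)]
        linarith
      have h3 : t ^ 2 ≤ 4 * ‖x‖ ^ 2 * (1 / (n + 1 + 1) ^ 2) := by
        have : t ^ 2 ≤ (2 * ‖x‖ / (n + 1 + 1)) ^ 2 := by
          have : 0 ≤ t := norm_nonneg _
          gcongr
        refine this.trans (le_of_eq ?_)
        rw [div_pow, mul_pow, mul_one_div]
        norm_num
      have h4 : (1 : ℝ) / (n + 1 + 1) ^ 2 ≤ 1 / (n + 1) - 1 / (n + 1 + 1) := by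
        rw [div_sub_div _ _ (by positivity) (by positivity), div_le_div_iff₀ (by positivity)
          (by positivity)]
        nlinarith
      have h5 := mul_le_mul_of_nonneg_left h4 (show 0 ≤ 4 * ‖x‖ ^ 2 by positivity)
      linarith
  rcases s.eq_empty_or_nonempty with rfl | hs
  · simp
  · obtain ⟨n, hn⟩ := Nat.exists_eq_succ_of_ne_zero hs.card_pos.ne'
    refine (key n s hn).trans ?_
    have h1 : (0 : ℝ) ≤ 1 / ((n : ℝ) + 1) := by positivity
    nlinarith [sq_nonneg ‖x‖]

/-! ### Sequences that are null for the supremum norm of the coordinates -/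

/-- The coordinates of `x n` tend to zero uniformly. -/
def SupNull (x : ℕ → Schreier 𝕜) : Prop :=
  ∀ ε > 0, ∀ᶠ n in atTop, ∀ j, ‖coord 𝕜 j (x n)‖ ≤ ε

theorem SupNull.comp_tendsto {x : ℕ → Schreier 𝕜} (hx : SupNull x) {f : ℕ → ℕ}
    (hf : Tendsto f atTop atTop) : SupNull (x ∘ f) :=
  fun ε hε => hf.eventually (hx ε hε)

theorem SupNull.exists_isWUCWith {x : ℕ → Schreier 𝕜} (hx : SupNull x) {M : ℝ}
    (hM : ∀ n, ‖x n‖ ≤ M) :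
    ∃ φ : ℕ → ℕ, StrictMono φ ∧ ∃ C, IsWUCWith 𝕜 C (x ∘ φ) := by
  have hM0 : 0 ≤ M := (norm_nonneg _).trans (hM 0)
  -- Of an earlier and a later term, every admissible set finds one negligible: a set far to the
  -- right misses the earlier one, and any other set has few elements, on which the later one has
  -- tiny coordinates.
  obtain ⟨φ, hφ, h⟩ := exists_strictMono_forall_lt (R := fun m l n => ∀ A, Admissible A →
      ∑ j ∈ A, ‖coord 𝕜 j (x m)‖ ≤ (1 / 2) ^ m ∨ ∑ j ∈ A, ‖coord 𝕜 j (x n)‖ ≤ (1 / 2) ^ l)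
    (by
      intro m l
      obtain ⟨N, hN⟩ := exists_tail_sum_le (x m) (δ := (1 / 2) ^ m) (by positivity)
      filter_upwards [hx ((1 / 2) ^ l / (N + 1)) (by positivity)] with n hn A hA
      by_cases hA' : ∀ j ∈ A, N < (j : ℕ)
      · exact Or.inl (hN A hA hA')
      · right
        push Not at hA'
        obtain ⟨j, hj, hjN⟩ := hA'
        have h1 : (A.card : ℝ) ≤ N + 1 := by
          have := (hA j hj).trans hjN
          exact_mod_cast this.trans N.le_succ
        calc ∑ j ∈ A, ‖coord 𝕜 j (x n)‖ ≤ A.card • ((1 / 2 : ℝ) ^ l / (N + 1)) :=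
              Finset.sum_le_card_nsmul _ _ _ fun j _ => hn j
          _ ≤ (N + 1) * ((1 / 2 : ℝ) ^ l / (N + 1)) := by
              rw [nsmul_eq_mul]
              gcongr
          _ = (1 / 2) ^ l := by field_simp)
    (by
      intro m l l' n hl h A hA
      refine (h A hA).imp_right fun h => h.trans ?_
      exact pow_le_pow_of_le_one (by norm_num) (by norm_num) hl)
  -- `M` pays for the single term that may be heavy on `A`, and 2 for the geometric series bounding
  -- all the others.
  refine ⟨φ, hφ, M + 2, fun s a ha => norm_le_of_forall_sum_le fun A hA => ?_⟩
  set q : ℕ → ℝ := fun k => ∑ j ∈ A, ‖coord 𝕜 j (x (φ k))‖ with hq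
  have hq0 : ∀ k, 0 ≤ q k := fun k => Finset.sum_nonneg fun _ _ => norm_nonneg _
  have h1 : ∑ j ∈ A, ‖coord 𝕜 j (∑ k ∈ s, a k • (x ∘ φ) k)‖ ≤ ∑ k ∈ s, q k := by
    rw [hq, Finset.sum_comm]
    refine Finset.sum_le_sum fun j _ => ?_
    rw [map_sum]
    refine (norm_sum_le _ _).trans (Finset.sum_le_sum fun k _ => ?_)
    rw [map_smul, norm_smul]
    exact mul_le_of_le_one_left (norm_nonneg _) (ha k)
  have hgeom : ∀ t : Finset ℕ, ∑ k ∈ t, (1 / 2 : ℝ) ^ k ≤ 2 := fun t =>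
    (summable_geometric_two.sum_le_tsum t fun _ _ => by positivity).trans_eq tsum_geometric_two
  refine h1.trans ?_
  by_cases hex : ∃ k₀ ∈ s, (1 / 2) ^ k₀ < q k₀
  · obtain ⟨k₀, hk₀, hlt⟩ := hex
    rw [← Finset.add_sum_erase s _ hk₀]
    refine add_le_add ((sum_le_norm _ hA).trans (hM _)) (le_trans ?_ (hgeom (s.erase k₀)))
    refine Finset.sum_le_sum fun k hk => ?_
    have hpow : ∀ i, (1 / 2 : ℝ) ^ φ i ≤ (1 / 2) ^ i := fun i =>
      pow_le_pow_of_le_one (by norm_num) (by norm_num) hφ.le_apply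
    rcases lt_or_gt_of_ne (Finset.ne_of_mem_erase hk) with hlt' | hlt'
    · rcases h k k₀ hlt' A hA with h2 | h2
      · exact h2.trans (hpow k)
      · exact absurd h2 (not_le.2 hlt)
    · rcases h k₀ k hlt' A hA with h2 | h2
      · exact absurd (h2.trans (hpow k₀)) (not_le.2 hlt)
      · exact h2
  · push Not at hex
    exact (Finset.sum_le_sum hex).trans ((hgeom s).trans (by linarith))

/-- Large coordinates must move to infinity because each fixed coordinate tends to zero, so a sparse
choice makes the matrix of coordinates nearly diagonal. The exponent `max k l + 3` makes
off-diagonal rows and columns sum to less than $\varepsilon/2$. -/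
theorem exists_hump {x : ℕ → Schreier 𝕜} (hc : ∀ j, Tendsto (fun n => coord 𝕜 j (x n)) atTop (𝓝 0))
    (hx : ¬ SupNull x) :
    ∃ ε > 0, ∃ φ : ℕ → ℕ, StrictMono φ ∧ ∃ j : ℕ → ℕ+, StrictMono j ∧
      (∀ k, ε ≤ ‖coord 𝕜 (j k) (x (φ k))‖) ∧
      ∀ k l, k ≠ l → ‖coord 𝕜 (j k) (x (φ l))‖ ≤ ε * (1 / 2) ^ (max k l + 3) := by
  unfold SupNull at hx
  push Not at hx
  obtain ⟨ε, hε, hfreq⟩ := hx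
  obtain ⟨ψ, hψ, hψ'⟩ := extraction_of_frequently_atTop hfreq
  choose i hi using hψ'
  have hi_top : ∀ N : ℕ, ∀ᶠ n in atTop, N < (i n : ℕ) := by
    intro N
    have h1 : ∀ᶠ n in atTop, ∀ j ∈ Finset.Icc (1 : ℕ+) N.succPNat, ‖coord 𝕜 j (x (ψ n))‖ < ε := by
      refine (Filter.eventually_all_finset _).2 fun j _ => ?_
      have := ((hc j).comp hψ.tendsto_atTop).norm
      rw [norm_zero] at this
      exact this.eventually_lt_const hε
    filter_upwards [h1] with n hn
    by_contra hcon
    have hle : i n ≤ N.succPNat := by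
      rw [← PNat.coe_le_coe, Nat.succPNat_coe]
      omega
    exact absurd (hn (i n) (Finset.mem_Icc.2 ⟨one_le, hle⟩)) (not_lt.2 (hi n).le)
  obtain ⟨φ, hφ, h⟩ := exists_strictMono_forall_lt (R := fun m l n => i m < i n ∧
      ‖coord 𝕜 (i m) (x (ψ n))‖ ≤ ε * (1 / 2) ^ (l + 3) ∧
      ‖coord 𝕜 (i n) (x (ψ m))‖ ≤ ε * (1 / 2) ^ (l + 3))
    (by
      intro m l
      have hpos : 0 < ε * (1 / 2 : ℝ) ^ (l + 3) := by positivity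
      refine (hi_top (i m)).and (Eventually.and ?_ ?_)
      · have := ((hc (i m)).comp hψ.tendsto_atTop).norm
        rw [norm_zero] at this
        exact (this.eventually_lt_const hpos).mono fun _ h => le_of_lt h
      · obtain ⟨N, hN⟩ := exists_tail_sum_le (x (ψ m)) hpos
        filter_upwards [hi_top N] with n hn
        simpa using hN {i n} (SchreierC00.admissible_singleton _) (by simpa using hn))
    (by
      intro m l l' n hl h
      have : ε * (1 / 2 : ℝ) ^ (l + 3) ≤ ε * (1 / 2 : ℝ) ^ (l' + 3) :=
        mul_le_mul_of_nonneg_left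
          (pow_le_pow_of_le_one (by norm_num) (by norm_num) (by omega)) hε.le
      exact ⟨h.1, h.2.1.trans this, h.2.2.trans this⟩)
  refine ⟨ε, hε, ψ ∘ φ, hψ.comp hφ, i ∘ φ, fun k l hkl => (h k l hkl).1,
    fun k => (hi _).le, fun k l hkl => ?_⟩
  rcases lt_or_gt_of_ne hkl with hlt | hlt
  · rw [max_eq_right hlt.le]
    exact (h k l hlt).2.1
  · rw [max_eq_left hlt.le]
    exact (h l k hlt).2.2

end Schreier

namespace Schreier

variable {𝕜 : Type*} [RCLike 𝕜]

/-! ### `𝒫`-null sequences -/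

/-- The quadratic form `x ↦ ∑ x (j k) ^ 2` along injectively chosen coordinates. -/
theorem exists_isHomogeneousPolynomial_two {j : ℕ → ℕ+} (hj : Function.Injective j) :
    ∃ P : Schreier 𝕜 → 𝕜, IsHomogeneousPolynomial 𝕜 2 P ∧
      ∀ x, HasSum (fun k => coord 𝕜 (j k) x ^ 2) (P x) := by
  have hsq : ∀ x : Schreier 𝕜, Summable (fun k => ‖coord 𝕜 (j k) x‖ ^ 2) ∧
      ∑' k, ‖coord 𝕜 (j k) x‖ ^ 2 ≤ 8 * ‖x‖ ^ 2 := by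
    intro x
    have : ∀ s : Finset ℕ, ∑ k ∈ s, ‖coord 𝕜 (j k) x‖ ^ 2 ≤ 8 * ‖x‖ ^ 2 := by
      intro s
      simpa using sum_sq_le x (s.map ⟨j, hj⟩)
    exact ⟨summable_of_sum_le (fun _ => by positivity) this,
      Real.tsum_le_of_sum_le (fun _ => by positivity) this⟩
  have hmul : ∀ x y : Schreier 𝕜, Summable (fun k => coord 𝕜 (j k) x * coord 𝕜 (j k) y) := by
    intro x y
    refine Summable.of_norm_bounded ((hsq x).1.add (hsq y).1) fun k => ?_
    rw [norm_mul]
    nlinarith [two_mul_le_add_sq ‖coord 𝕜 (j k) x‖ ‖coord 𝕜 (j k) y‖,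
      norm_nonneg (coord 𝕜 (j k) x), norm_nonneg (coord 𝕜 (j k) y)]
  have hbound : ∀ x y : Schreier 𝕜,
      ‖∑' k, coord 𝕜 (j k) x * coord 𝕜 (j k) y‖ ≤ 8 * ‖x‖ * ‖y‖ := by
    intro x y
    refine le_of_tendsto (hmul x y).hasSum.norm (Eventually.of_forall fun s => ?_)
    -- Prepares Cauchy–Schwarz on finite sums; the factor 8 is that of `sum_sq_le`.
    have hs : ∀ x : Schreier 𝕜, √(∑ k ∈ s, ‖coord 𝕜 (j k) x‖ ^ 2) ≤ √8 * ‖x‖ := by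
      intro x
      rw [← Real.sqrt_sq (norm_nonneg x), ← Real.sqrt_mul (by norm_num)]
      exact Real.sqrt_le_sqrt (((hsq x).1.sum_le_tsum s fun _ _ => by positivity).trans (hsq x).2)
    calc ‖∑ k ∈ s, coord 𝕜 (j k) x * coord 𝕜 (j k) y‖
        ≤ ∑ k ∈ s, ‖coord 𝕜 (j k) x‖ * ‖coord 𝕜 (j k) y‖ := by
          simpa only [norm_mul] using norm_sum_le s fun k => coord 𝕜 (j k) x * coord 𝕜 (j k) y
      _ ≤ √(∑ k ∈ s, ‖coord 𝕜 (j k) x‖ ^ 2) * √(∑ k ∈ s, ‖coord 𝕜 (j k) y‖ ^ 2) :=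
          Real.sum_mul_le_sqrt_mul_sqrt _ _ _
      _ ≤ (√8 * ‖x‖) * (√8 * ‖y‖) := mul_le_mul (hs x) (hs y) (by positivity) (by positivity)
      _ = (√8 * √8) * ‖x‖ * ‖y‖ := by ring
      _ = 8 * ‖x‖ * ‖y‖ := by rw [Real.mul_self_sqrt (by norm_num)]
  let B : Schreier 𝕜 →ₗ[𝕜] Schreier 𝕜 →ₗ[𝕜] 𝕜 :=
    LinearMap.mk₂ 𝕜 (fun x y => ∑' k, coord 𝕜 (j k) x * coord 𝕜 (j k) y)
      (fun x x' y => by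
        simp only [map_add, add_mul]
        exact (hmul x y).tsum_add (hmul x' y))
      (fun c x y => by
        simp only [map_smul, smul_eq_mul, mul_assoc]
        exact tsum_mul_left)
      (fun x y y' => by
        simp only [map_add, mul_add]
        exact (hmul x y).tsum_add (hmul x y'))
      (fun c x y => by
        simp only [map_smul, smul_eq_mul, mul_left_comm _ c]
        exact tsum_mul_left)
  let B' : Schreier 𝕜 →L[𝕜] Schreier 𝕜 →L[𝕜] 𝕜 := B.mkContinuous₂ 8 hbound
  -- `uncurryBilinear` takes both of its arguments in the product space, so each vector is first
  -- doubled.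
  let Δ : Schreier 𝕜 →L[𝕜] Schreier 𝕜 × Schreier 𝕜 :=
    (ContinuousLinearMap.id 𝕜 _).prod (ContinuousLinearMap.id 𝕜 _)
  refine ⟨fun x => ∑' k, coord 𝕜 (j k) x ^ 2,
    ⟨B'.uncurryBilinear.compContinuousLinearMap fun _ => Δ, fun x => ?_⟩, fun x => ?_⟩
  · simp only [sq]
    rfl
  · simpa only [sq] using (hmul x x).hasSum

theorem _root_.IsPNull.tendsto_clm {E : Type*} [NormedAddCommGroup E] [NormedSpace 𝕜 E]
    {x : ℕ → E} (hx : IsPNull 𝕜 x) (f : E →L[𝕜] 𝕜) :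
    Tendsto (fun n => f (x n)) atTop (𝓝 0) := by
  have := hx 1 f ⟨ContinuousMultilinearMap.ofSubsingleton 𝕜 E 𝕜 (0 : Fin 1) f, fun x => by simp⟩
  simpa using this

/-- Degree one polynomials give weak boundedness; uniform boundedness in the bidual does the rest.
-/
theorem _root_.IsPNull.exists_norm_le {E : Type*} [NormedAddCommGroup E] [NormedSpace 𝕜 E]
    {x : ℕ → E} (hx : IsPNull 𝕜 x) : ∃ M, ∀ n, ‖x n‖ ≤ M := by
  obtain ⟨M, hM⟩ := banach_steinhaus
    (g := fun n => NormedSpace.inclusionInDoubleDual 𝕜 E (x n)) (fun f => by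
      obtain ⟨C, hC⟩ := (hx.tendsto_clm f).norm.bddAbove_range
      exact ⟨C, fun n => hC ⟨n, rfl⟩⟩)
  refine ⟨M, fun n => ?_⟩
  rw [← (NormedSpace.inclusionInDoubleDualLi 𝕜 (E := E)).norm_map]
  exact hM n

theorem supNull_of_isPNull {x : ℕ → Schreier 𝕜} (hx : IsPNull 𝕜 x) : SupNull x := by
  by_contra hcon
  obtain ⟨ε, hε, φ, hφ, j, hj, h1, h2⟩ := exists_hump (fun j => hx.tendsto_clm (coord 𝕜 j)) hcon
  obtain ⟨P, hP, hsum⟩ := exists_isHomogeneousPolynomial_two (𝕜 := 𝕜) hj.injective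
  have hP0 : P 0 = 0 := (hsum 0).unique (by simp)
  have hlim := ((hx 2 P hP).comp hφ.tendsto_atTop).norm
  rw [hP0, norm_zero] at hlim
  obtain ⟨k, hk⟩ := (hlim.eventually_lt_const (show 0 < ε ^ 2 / 2 by positivity)).exists
  -- The off-diagonal squares sum to at most $\varepsilon^2/2$, while the diagonal one is at least
  -- $\varepsilon^2$. Hence $P(x_{\varphi(k)})$ cannot be small.
  have hk' : ‖P (x (φ k)) - coord 𝕜 (j k) (x (φ k)) ^ 2‖ ≤ ε ^ 2 / 2 := by
    have h3 := (hsum (x (φ k))).update k 0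
    rw [zero_sub, neg_add_eq_sub] at h3
    rw [← h3.tsum_eq]
    refine tsum_of_norm_bounded (hasSum_geometric_two' (ε ^ 2 / 2 : ℝ)) fun i => ?_
    rcases eq_or_ne i k with rfl | hi
    · simp only [Function.update_self, norm_zero]
      positivity
    · rw [Function.update_of_ne hi, norm_pow]
      have h4 := h2 i k hi
      have h5 : (1 / 2 : ℝ) ^ (max i k + 3) ≤ (1 / 2) ^ (i + 2) :=
        pow_le_pow_of_le_one (by norm_num) (by norm_num) (by omega)
      have h6 : (1 / 2 : ℝ) ^ (max i k + 3) ≤ 1 :=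
        pow_le_one₀ (by norm_num) (by norm_num)
      have h7 : (0 : ℝ) ≤ (1 / 2 : ℝ) ^ (max i k + 3) := by positivity
      calc ‖coord 𝕜 (j i) (x (φ k))‖ ^ 2 ≤ (ε * (1 / 2) ^ (max i k + 3)) ^ 2 := by gcongr
        _ = ε ^ 2 * ((1 / 2) ^ (max i k + 3) * (1 / 2) ^ (max i k + 3)) := by ring
        _ ≤ ε ^ 2 * ((1 / 2) ^ (i + 2) * 1) := by gcongr
        _ = ε ^ 2 / 2 / 2 / 2 ^ i := by
          rw [one_div, inv_pow, pow_add]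
          field_simp
  have h3 : ‖coord 𝕜 (j k) (x (φ k)) ^ 2‖ < ε ^ 2 := by
    have := norm_sub_norm_le (coord 𝕜 (j k) (x (φ k)) ^ 2) (P (x (φ k)))
    rw [norm_sub_rev] at this
    have hk2 : ‖P (x (φ k))‖ < ε ^ 2 / 2 := hk
    linarith
  rw [norm_pow] at h3
  exact absurd h3 (not_lt.2 (pow_le_pow_left₀ hε.le (h1 k) 2))

/-! ### Banach–Saks sets -/

theorem exists_tendsto_coord {x : ℕ → Schreier 𝕜} {M : ℝ} (hM : ∀ n, ‖x n‖ ≤ M) :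
    ∃ φ : ℕ → ℕ, StrictMono φ ∧ ∃ c : ℕ+ → 𝕜,
      ∀ j, Tendsto (fun n => coord 𝕜 j (x (φ n))) atTop (𝓝 (c j)) := by
  have hK : IsCompact (Set.univ.pi fun _ : ℕ+ => Metric.closedBall (0 : 𝕜) M) :=
    isCompact_univ_pi fun _ => isCompact_closedBall 0 M
  obtain ⟨c, -, φ, hφ, h⟩ := hK.tendsto_subseq (x := fun n j => coord 𝕜 j (x n)) fun n j _ => by
    simpa using (norm_coord_le (x n) j).trans (hM n)
  exact ⟨φ, hφ, c, fun j => tendsto_pi_nhds.1 h j⟩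

theorem _root_.IsBanachSaksSet.exists_norm_le {E : Type*} [NormedAddCommGroup E] [NormedSpace 𝕜 E]
    {A : Set E} (hA : IsBanachSaksSet 𝕜 A) : ∃ M, ∀ x ∈ A, ‖x‖ ≤ M := by
  by_contra hcon
  push Not at hcon
  choose x hxA hx using fun n : ℕ => hcon (n + 1)
  obtain ⟨φ, hφ, a, ha⟩ := hA x hxA
  -- The mean of length $N+1$ minus $\frac{N}{N+1}$ times the mean of length $N$ is
  -- $x_{\varphi(N)}/(N+1)$. It tends to zero, but its norm exceeds 1 by the choice of `x`.
  have h1 := (tendsto_add_atTop_iff_nat 1).2 ha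
  have h2 := (tendsto_natCast_div_add_atTop (𝕜 := 𝕜) 1).smul ha
  have h3 := (h1.sub h2).norm
  rw [one_smul, sub_self, norm_zero] at h3
  obtain ⟨N, hN⟩ := (h3.eventually_lt_const one_pos).and (eventually_gt_atTop 0) |>.exists
  obtain ⟨hN, hN0⟩ := hN
  have hN' : (N : 𝕜) ≠ 0 := by exact_mod_cast hN0.ne'
  rw [Finset.sum_range_succ, smul_smul, div_eq_inv_mul, mul_assoc, mul_inv_cancel₀ hN', mul_one,
    smul_add, Nat.cast_add_one, add_sub_cancel_left, norm_smul, norm_inv, ← Nat.cast_add_one,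
    RCLike.norm_natCast, inv_mul_lt_iff₀ (by positivity), mul_one] at hN
  have h4 := hx (φ N)
  have h5 : (N : ℝ) ≤ φ N := by exact_mod_cast hφ.le_apply
  push_cast at hN
  linarith

theorem tendsto_mean_of_tendsto {u : ℕ → 𝕜} {c : 𝕜} (h : Tendsto u atTop (𝓝 c)) :
    Tendsto (fun N : ℕ => (N : 𝕜)⁻¹ • ∑ i ∈ Finset.range N, u i) atTop (𝓝 c) := by
  refine h.cesaro_smul.congr fun N => ?_
  rw [RCLike.real_smul_eq_coe_smul (K := 𝕜)]
  simp

/-- Coordinatewise limits exist along a subsequence, and the Banach–Saks property supplies a vector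
`a` having them as coordinates. Persistent humps of $x-a$ would add up on an admissible set and keep
the norm of the means of $x-a$ above $\varepsilon/4$. -/
theorem exists_subseq_of_isBanachSaksSet {A : Set (Schreier 𝕜)} (hA : IsBanachSaksSet 𝕜 A)
    {x : ℕ → Schreier 𝕜} (hx : ∀ n, x n ∈ A) :
    ∃ φ : ℕ → ℕ, StrictMono φ ∧ ∃ a, SupNull fun n => x (φ n) - a := by
  obtain ⟨M, hM⟩ := hA.exists_norm_le
  obtain ⟨φ, hφ, c, hc⟩ := exists_tendsto_coord (fun n => hM _ (hx n))
  have hlim : ∀ ψ : ℕ → ℕ, StrictMono ψ → ∀ a, Tendsto (fun N : ℕ => (N : 𝕜)⁻¹ •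
      ∑ i ∈ Finset.range N, x (φ (ψ i))) atTop (𝓝 a) → ∀ j, coord 𝕜 j a = c j := by
    intro ψ hψ a ha j
    have h1 := ((coord 𝕜 j).continuous.tendsto a).comp ha
    have h2 := tendsto_mean_of_tendsto ((hc j).comp hψ.tendsto_atTop)
    refine tendsto_nhds_unique h1 (h2.congr fun N => ?_)
    simp
  obtain ⟨ψ, hψ, a, ha⟩ := hA (x ∘ φ) (fun n => hx _)
  have hca := hlim ψ hψ a ha
  refine ⟨φ, hφ, a, ?_⟩
  by_contra hcon
  obtain ⟨ε, hε, θ, hθ, j, hj, h1, h2⟩ := exists_hump (fun j => by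
    have := (hc j).sub_const (coord 𝕜 j a)
    rw [hca, sub_self] at this
    simpa [hca] using this) hcon
  obtain ⟨ρ, hρ, b, hb⟩ := hA (x ∘ φ ∘ θ) (fun n => hx _)
  obtain rfl : b = a := ext_coord fun i => by
    rw [hca, hlim (θ ∘ ρ) (hθ.comp hρ) b hb]
  -- Means of length $2N$ are used because the humps with indices in $[N,2N)$ sit at $N$ positions
  -- beyond $N$, an admissible set.
  have hb0 := (tendsto_iff_norm_sub_tendsto_zero.1 hb).comp
    (tendsto_id.const_mul_atTop' (show 0 < 2 by norm_num))
  obtain ⟨N, hN, hN0⟩ := ((hb0.eventually_lt_const (show 0 < ε / 4 by positivity)).and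
    (eventually_gt_atTop 0)).exists
  set w : ℕ → Schreier 𝕜 := fun i => x (φ (θ (ρ i))) - b with hw
  have hcast : ((2 * N : ℕ) : 𝕜) ≠ 0 := by
    have : 2 * N ≠ 0 := by omega
    exact_mod_cast this
  have hmean : ((2 * N : ℕ) : 𝕜)⁻¹ • ∑ i ∈ Finset.range (2 * N), x (φ (θ (ρ i))) - b =
      ((2 * N : ℕ) : 𝕜)⁻¹ • ∑ i ∈ Finset.range (2 * N), w i := by
    rw [hw, Finset.sum_sub_distrib, Finset.sum_const, Finset.card_range, smul_sub,
      ← Nat.cast_smul_eq_nsmul 𝕜, smul_smul, inv_mul_cancel₀ hcast, one_smul]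
  have hN2 : ‖∑ i ∈ Finset.range (2 * N), w i‖ < N * (ε / 2) := by
    have h3 : ‖((2 * N : ℕ) : 𝕜)⁻¹ • ∑ i ∈ Finset.range (2 * N), x (φ (θ (ρ i))) - b‖ < ε / 4 := hN
    have : (0 : ℝ) < (2 * N : ℕ) := by exact_mod_cast (by omega : 0 < 2 * N)
    rw [hmean, norm_smul, norm_inv, RCLike.norm_natCast, inv_mul_lt_iff₀ this] at h3
    push_cast at h3
    linarith
  have hinj : Function.Injective fun i => j (ρ i) := (hj.comp hρ).injective
  set A' : Finset ℕ+ := (Finset.Ico N (2 * N)).map ⟨fun i => j (ρ i), hinj⟩ with hA'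
  have hcard : A'.card = N := by
    rw [hA', Finset.card_map, Nat.card_Ico]
    omega
  have hjle : ∀ k, k < (j k : ℕ) := by
    intro k
    induction k with
    | zero => exact (j 0).pos
    | succ k ih => exact lt_of_le_of_lt ih (PNat.coe_lt_coe _ _ |>.2 (hj k.lt_succ_self))
  have hadm : Admissible A' := by
    intro n hn
    obtain ⟨i, hi, rfl⟩ := Finset.mem_map.1 hn
    rw [hcard]
    exact ((Finset.mem_Ico.1 hi).1.trans hρ.le_apply).trans (hjle _).le
  -- The hump contributes at least $\varepsilon$, and the other terms together at most
  -- $\varepsilon/2$ at that coordinate.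
  have hlow : ∀ i ∈ Finset.Ico N (2 * N),
      ε / 2 ≤ ‖coord 𝕜 (j (ρ i)) (∑ l ∈ Finset.range (2 * N), w l)‖ := by
    intro i hi
    have hi' : i ∈ Finset.range (2 * N) := Finset.mem_range.2 (Finset.mem_Ico.1 hi).2
    rw [← Finset.add_sum_erase _ _ hi', map_add]
    have h3 : ‖coord 𝕜 (j (ρ i)) (∑ l ∈ (Finset.range (2 * N)).erase i, w l)‖ ≤ ε / 2 := by
      rw [map_sum]
      refine (norm_sum_le _ _).trans ?_
      calc ∑ l ∈ (Finset.range (2 * N)).erase i, ‖coord 𝕜 (j (ρ i)) (w l)‖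
          ≤ ∑ l ∈ (Finset.range (2 * N)).erase i, ε / 4 * (1 / 2) ^ l := by
            refine Finset.sum_le_sum fun l hl => ?_
            have hne := hρ.injective.ne (Finset.ne_of_mem_erase hl)
            refine (h2 (ρ i) (ρ l) hne.symm).trans ?_
            have h4 : (1 / 2 : ℝ) ^ (max (ρ i) (ρ l) + 3) ≤ (1 / 2) ^ (l + 2) :=
              pow_le_pow_of_le_one (by norm_num) (by norm_num) (by
                have := hρ.le_apply (x := l)
                omega)
            calc ε * (1 / 2 : ℝ) ^ (max (ρ i) (ρ l) + 3) ≤ ε * (1 / 2) ^ (l + 2) := by gcongr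
              _ = ε / 4 * (1 / 2) ^ l := by ring
        _ ≤ ε / 4 * 2 := by
            rw [← Finset.mul_sum]
            gcongr
            exact (summable_geometric_two.sum_le_tsum _ fun _ _ => by positivity).trans_eq
              tsum_geometric_two
        _ = ε / 2 := by ring
    have h4 := norm_sub_norm_le (coord 𝕜 (j (ρ i)) (w i))
      (-coord 𝕜 (j (ρ i)) (∑ l ∈ (Finset.range (2 * N)).erase i, w l))
    rw [norm_neg, sub_neg_eq_add] at h4
    have h5 : ε ≤ ‖coord 𝕜 (j (ρ i)) (w i)‖ := h1 (ρ i)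
    linarith
  have hfin := sum_le_norm (∑ l ∈ Finset.range (2 * N), w l) hadm
  rw [hA', Finset.sum_map] at hfin
  have hfin2 := Finset.card_nsmul_le_sum _ _ _ hlow
  rw [Nat.card_Ico, nsmul_eq_mul, show 2 * N - N = N by omega] at hfin2
  exact absurd hN2 (not_lt.2 (hfin2.trans hfin))

end Schreier

/-! ### Elementary tensors -/

theorem Matrix.update_vecCons_zero {α : Type*} (a b c : α) :
    Function.update ![a, b] 0 c = ![c, b] := by
  ext i
  fin_cases i <;> simp

theorem Matrix.update_vecCons_one {α : Type*} (a b c : α) :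
    Function.update ![a, b] 1 c = ![a, c] := by
  ext i
  fin_cases i <;> simp

/-- The bilinear map `(a, b) ↦ a ⊗ b` into the projective tensor product. -/
noncomputable def elemTensorL (𝕜 E : Type*) [RCLike 𝕜] [NormedAddCommGroup E] [NormedSpace 𝕜 E] :
    E →L[𝕜] E →L[𝕜] ProjectiveTensorSquare 𝕜 E :=
  LinearMap.mkContinuous₂
    ((LinearMap.mk₂ 𝕜 (fun a b => (PiTensorProduct.tprod 𝕜 ![a, b] : ⨂[𝕜] _ : Fin 2, E))
      (fun a a' b => by
        have := (PiTensorProduct.tprod 𝕜 (s := fun _ : Fin 2 => E)).map_update_add ![a, b] 0 a a'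
        simpa only [Matrix.update_vecCons_zero] using this)
      (fun c a b => by
        have := (PiTensorProduct.tprod 𝕜 (s := fun _ : Fin 2 => E)).map_update_smul ![a, b] 0 c a
        simpa only [Matrix.update_vecCons_zero] using this)
      (fun a b b' => by
        have := (PiTensorProduct.tprod 𝕜 (s := fun _ : Fin 2 => E)).map_update_add ![a, b] 1 b b'
        simpa only [Matrix.update_vecCons_one] using this)
      (fun c a b => by
        have := (PiTensorProduct.tprod 𝕜 (s := fun _ : Fin 2 => E)).map_update_smul ![a, b] 1 c b
        simpa only [Matrix.update_vecCons_one] using this)).compr₂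
      (UniformSpace.Completion.toComplL :
        (⨂[𝕜] _ : Fin 2, E) →L[𝕜] ProjectiveTensorSquare 𝕜 E).toLinearMap) 1
    fun a b => by
      have := PiTensorProduct.projectiveSeminorm_tprod_le (𝕜 := 𝕜) ![a, b]
      rw [Fin.prod_univ_two] at this
      rw [one_mul]
      exact (UniformSpace.Completion.norm_coe _).trans_le this

@[simp] theorem elemTensorL_apply {𝕜 E : Type*} [RCLike 𝕜] [NormedAddCommGroup E] [NormedSpace 𝕜 E]
    (a b : E) : elemTensorL 𝕜 E a b = elemTensor 𝕜 a b := rfl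

section

variable {𝕜 : Type*} [RCLike 𝕜]

/-- The identity $x\otimes y-a\otimes b=(x-a)\otimes(y-b)+(x-a)\otimes b+a\otimes(y-b)$ splits the
difference into one bilinear and two linear images of wuc sequences. -/
theorem exists_isWUCWith_elemTensor_sub {x y : ℕ → Schreier 𝕜} {a b : Schreier 𝕜}
    (hx : Schreier.SupNull fun n => x n - a) (hy : Schreier.SupNull fun n => y n - b)
    {M : ℝ} (hxM : ∀ n, ‖x n‖ ≤ M) (hyM : ∀ n, ‖y n‖ ≤ M) :
    ∃ φ : ℕ → ℕ, StrictMono φ ∧ ∃ C,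
      IsWUCWith 𝕜 C (fun n => elemTensor 𝕜 (x (φ n)) (y (φ n)) - elemTensor 𝕜 a b) := by
  obtain ⟨φ, hφ, C, hC⟩ := hx.exists_isWUCWith (M := M + ‖a‖) fun n =>
    (norm_sub_le _ _).trans (by gcongr; exact hxM n)
  obtain ⟨ψ, hψ, D, hD⟩ := (hy.comp_tendsto hφ.tendsto_atTop).exists_isWUCWith
    (M := M + ‖b‖) fun n => (norm_sub_le _ _).trans (by gcongr; exact hyM _)
  have hC' := hC.comp hψ.injective
  refine ⟨φ ∘ ψ, hφ.comp hψ, ?_⟩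
  have h := ((hC'.bilinear hD (elemTensorL 𝕜 _)).add
    (hC'.map ((elemTensorL 𝕜 (Schreier 𝕜)).flip b))).add (hD.map (elemTensorL 𝕜 _ a))
  have heq : (fun n => elemTensor 𝕜 (x ((φ ∘ ψ) n)) (y ((φ ∘ ψ) n)) - elemTensor 𝕜 a b) =
      fun n => elemTensorL 𝕜 _ (x (φ (ψ n)) - a) (y (φ (ψ n)) - b) +
        (elemTensorL 𝕜 (Schreier 𝕜)).flip b (x (φ (ψ n)) - a) +
        elemTensorL 𝕜 _ a (y (φ (ψ n)) - b) := by
    funext n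
    simp only [← elemTensorL_apply, ContinuousLinearMap.flip_apply, map_sub, sub_apply,
      Function.comp_apply]
    abel
  rw [heq]
  exact ⟨_, h⟩

end

theorem mainTheorem8 {𝕜 : Type*} [RCLike 𝕜] :
    (∀ x y : ℕ → Schreier 𝕜, IsPNull 𝕜 x → IsPNull 𝕜 y →
      IsBanachSaksSet 𝕜 (Set.range fun n => elemTensor 𝕜 (x n) (y n)) ∧
      IsPNull 𝕜 (fun n => elemTensor 𝕜 (x n) (y n))) ∧
    (∀ A B : Set (Schreier 𝕜), IsBanachSaksSet 𝕜 A → IsBanachSaksSet 𝕜 B →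
      IsBanachSaksSet 𝕜 (Set.image2 (elemTensor 𝕜) A B)) := by
  have hzero : elemTensor 𝕜 (0 : Schreier 𝕜) 0 = 0 := by simp [← elemTensorL_apply]
  refine ⟨fun x y hx hy => ?_, fun A B hA hB z hz => ?_⟩
  · have key : ∀ f : ℕ → ℕ, Tendsto f atTop atTop → ∃ φ : ℕ → ℕ, StrictMono φ ∧ ∃ C,
        IsWUCWith 𝕜 C (fun n => elemTensor 𝕜 (x (f (φ n))) (y (f (φ n)))) := by
      intro f hf
      obtain ⟨M, hM⟩ := hx.exists_norm_le
      obtain ⟨M', hM'⟩ := hy.exists_norm_le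
      have h := exists_isWUCWith_elemTensor_sub (x := x ∘ f) (y := y ∘ f) (a := 0) (b := 0)
        (M := max M M')
        (by simpa using! (Schreier.supNull_of_isPNull hx).comp_tendsto hf)
        (by simpa using! (Schreier.supNull_of_isPNull hy).comp_tendsto hf)
        (fun n => (hM _).trans (le_max_left _ _)) (fun n => (hM' _).trans (le_max_right _ _))
      simpa only [hzero, sub_zero] using! h
    refine ⟨fun z hz => ?_, fun k P hP => ?_⟩
    · choose f hf using hz
      rcases exists_strictMono_eq_or_tendsto f with ⟨φ, hφ, c, hc⟩ | hf'
      · refine ⟨φ, hφ, elemTensor 𝕜 (x c) (y c), ?_⟩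
        refine IsWUCWith.tendsto_mean (C := 0) fun s a _ => ?_
        simp [← hf, hc]
      · obtain ⟨φ, hφ, C, hC⟩ := key f hf'
        refine ⟨φ, hφ, 0, IsWUCWith.tendsto_mean (C := C) ?_⟩
        simpa only [hf, sub_zero] using hC
    -- Only subsequences are wuc, so convergence is tested by extracting from an arbitrary
    -- subsequence.
    · refine tendsto_of_subseq_tendsto fun f hf => ?_
      obtain ⟨φ, -, C, hC⟩ := key f hf
      exact ⟨φ, hC.tendsto_polynomial hP⟩
  · choose a haA b hbB hab using hz
    obtain ⟨M, hM⟩ := hA.exists_norm_le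
    obtain ⟨M', hM'⟩ := hB.exists_norm_le
    obtain ⟨φ, hφ, a₀, ha₀⟩ := Schreier.exists_subseq_of_isBanachSaksSet hA haA
    obtain ⟨ψ, hψ, b₀, hb₀⟩ := Schreier.exists_subseq_of_isBanachSaksSet hB (fun n => hbB (φ n))
    obtain ⟨θ, hθ, C, hC⟩ := exists_isWUCWith_elemTensor_sub (M := max M M')
      (ha₀.comp_tendsto hψ.tendsto_atTop) hb₀
      (fun n => (hM _ (haA _)).trans (le_max_left _ _))
      (fun n => (hM' _ (hbB _)).trans (le_max_right _ _))
    refine ⟨φ ∘ ψ ∘ θ, hφ.comp (hψ.comp hθ), elemTensor 𝕜 a₀ b₀,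
      IsWUCWith.tendsto_mean (C := C) ?_⟩
    simpa only [← hab] using! hC
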